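/- A \emph{cycle set} is a finite set $X$ with a binary operation $\ast$ such that $\sigma_x : X \to X,\ y \mapsto x \ast y$ is bijective for every $x \in X$, such that $(x \ast y) \ast (x \ast z) = (y \ast x) \ast (y \ast z)$ for all $x,y,z \in X$, and such that the diagonal map $T : X \to X,\ x \mapsto x \ast x$ is bijective. The \emph{retraction} of $X$ is the cycle set $X_{\mathrm{ret}} = X/{\sim}$, where $x \sim y \Leftrightarrow \sigma_x = \sigma_y$, with operation $[x] \ast [y] = [x \ast y]$. Put $X^{(0)} = X$ and $X^{(k+1)} = (X^{(k)})_{\mathrm{ret}}$ for $k \ge 0$. The \emph{multipermutation level} $\mathrm{mpl}(X)$ is the least $k \ge 0$ with $|X^{(k)}| = 1$, and $\mathrm{mpl}(X) = \infty$ if there is no such $k$. Isomorphisms of cycle sets are bijections that respect the operations. Let $X_{4,19}$ be the cycle set on $\{1,2,3,4\}$ with the multiplication table (row $x$, column $y$ contains $x \ast y$) \[ \begin{array}{c|cccc} \ast & 1 & 2 & 3 & 4 \\ \hline 1 & 2 & 1 & 3 & 4 \\ 2 & 4 & 3 & 1 & 2 \\ 3 & 1 & 2 & 4 & 3 \\ 4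 & 3 & 4 & 2 & 1 \end{array} \] \textbf{Corollary.} Let $X$ be a cycle set of size $n = 2^v$, where $v \ge 0$. If its diagonal map $T$ is an $n$-cycle (that is, a permutation of $X$ with a single orbit), then exactly one of the following two cases occurs: \begin{enumerate} \item $\mathrm{mpl}(X) < \infty$; \item there is a $k \ge 0$ such that $X^{(k)} \cong X_{4,19}$. \end{enumerate} -/

import Mathlib

universe u w

/-- A cycle set, always understood to be finite and nondegenerate: a finite set with a binary
operation `x ∗ y` such that every left multiplication `σ_x : y ↦ x ∗ y` is bijective (C1),
`(x ∗ y) ∗ (x ∗ z) = (y ∗ x) ∗ (y ∗ z)` (C2), and the diagonal `x ↦ x ∗ x` is bijective (C3). -/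
structure CycleSet : Type (u + 1) where
  carrier : Type u
  finite_carrier : Finite carrier
  op : carrier → carrier → carrier
  bijective_op : ∀ x, Function.Bijective (op x)
  op_op : ∀ x y z, op (op x y) (op x z) = op (op y x) (op y z)
  bijective_diag : Function.Bijective fun x => op x x

namespace CycleSet

instance (X : CycleSet.{u}) : Finite X.carrier := X.finite_carrier

/-- The permutation `σ_x : y ↦ x ∗ y`. -/
noncomputable def sigma (X : CycleSet.{u}) (x : X.carrier) : Equiv.Perm X.carrier :=
  Equiv.ofBijective (X.op x) (X.bijective_op x)

@[simp] theorem sigma_apply (X : CycleSet.{u}) (x y : X.carrier) : X.sigma x y = X.op x y := rfl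

/-- The diagonal map `T : x ↦ x ∗ x`, as a permutation. -/
noncomputable def diagonal (X : CycleSet.{u}) : Equiv.Perm X.carrier :=
  Equiv.ofBijective (fun x => X.op x x) X.bijective_diag

/-- The diagonal `T` is a full cycle, i.e. an `n`-cycle where `n` is the size of `X`: all points
of `X` lie on one single cycle of `T` (on a one-point set, the identity is a `1`-cycle). -/
def HasFullDiagonal (X : CycleSet.{u}) : Prop :=
  X.diagonal.IsCycleOn Set.univ

/-- The retraction relation: `x ∼ y` if and only if `σ_x = σ_y`. -/
noncomputable def retSetoid (X : CycleSet.{u}) : Setoid X.carrier :=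
  Setoid.ker X.sigma

theorem op_eq_of_ret {X : CycleSet.{u}} {x x' : X.carrier} (h : X.retSetoid x x')
    (y : X.carrier) : X.op x y = X.op x' y :=
  DFunLike.congr_fun (show X.sigma x = X.sigma x' from h) y

theorem ret_op_op {X : CycleSet.{u}} {x x' y y' : X.carrier} (hx : X.retSetoid x x')
    (hy : X.retSetoid y y') : X.retSetoid (X.op x y) (X.op x' y') := by
  show X.sigma (X.op x y) = X.sigma (X.op x' y')
  ext w
  obtain ⟨z, rfl⟩ := (X.bijective_op x).2 w
  rw [← op_eq_of_ret hx y']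
  simp only [sigma_apply]
  rw [X.op_op x y z, X.op_op x y' z, op_eq_of_ret hy, op_eq_of_ret hy]

/-- The retraction `X_ret = X / ∼` with the operation `[x] ∗ [y] = [x ∗ y]`. -/
noncomputable def ret (X : CycleSet.{u}) : CycleSet.{u} where
  carrier := Quotient X.retSetoid
  finite_carrier := inferInstance
  op := Quotient.map₂ X.op fun _ _ hx _ _ hy => ret_op_op hx hy
  bijective_op := by
    intro q
    refine Finite.injective_iff_bijective.mp (Finite.injective_iff_surjective.mpr ?_)
    intro r
    induction q using Quotient.inductionOn with | _ x =>
    induction r using Quotient.inductionOn with | _ y =>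
    obtain ⟨z, rfl⟩ := (X.bijective_op x).2 y
    exact ⟨Quotient.mk _ z, rfl⟩
  op_op := by
    intro p q r
    induction p using Quotient.inductionOn with | _ x =>
    induction q using Quotient.inductionOn with | _ y =>
    induction r using Quotient.inductionOn with | _ z =>
    exact congrArg (Quotient.mk X.retSetoid) (X.op_op x y z)
  bijective_diag := by
    refine Finite.injective_iff_bijective.mp (Finite.injective_iff_surjective.mpr ?_)
    intro r
    induction r using Quotient.inductionOn with | _ y =>
    obtain ⟨z, rfl⟩ := X.bijective_diag.2 y
    exact ⟨Quotient.mk _ z, rfl⟩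

/-- The iterated retractions: `X^(0) = X` and `X^(k+1) = (X^(k))_ret`. -/
noncomputable def iterRet (X : CycleSet.{u}) : ℕ → CycleSet.{u}
  | 0 => X
  | k + 1 => (X.iterRet k).ret

/-- The multipermutation level: the least `k` such that `X^(k)` has exactly one element, and `⊤`
(that is, infinity) if there is no such `k`. -/
noncomputable def mpl (X : CycleSet.{u}) : ℕ∞ :=
  ⨅ (k : ℕ) (_ : Nat.card (X.iterRet k).carrier = 1), (k : ℕ∞)

/-- Isomorphisms of cycle sets: bijections that respect the operation. -/
structure Iso (X : CycleSet.{u}) (Y : CycleSet.{w}) extends X.carrier ≃ Y.carrier where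
  map_op : ∀ x y, toFun (X.op x y) = Y.op (toFun x) (toFun y)

/-- The multiplication table of `X_{4,19}`, with the elements `1, 2, 3, 4` renamed to
`0, 1, 2, 3`; row `x`, column `y` holds `x ∗ y`. -/
def table419 : Fin 4 → Fin 4 → Fin 4 :=
  ![![1, 0, 2, 3],
    ![3, 2, 0, 1],
    ![0, 1, 3, 2],
    ![2, 3, 1, 0]]

/-- The cycle set `X_{4,19}`. -/
def X419 : CycleSet.{0} where
  carrier := Fin 4
  finite_carrier := inferInstance
  op := table419
  bijective_op := by decide
  op_op := by decide
  bijective_diag := by decide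

end CycleSet

open Equiv

/-! Retraction preserves the full diagonal cycle, and the size of the retraction divides the size of
`X`. By induction it suffices that an irretractable `X` is a point or `X419`. As `X419` is
irretractable, a sequence of retractions that reaches it stays there, so the two cases exclude each
other.

Label the points by `ZMod (2 ^ (u + 1))` so that `T` is `x ↦ x + 1`, and put `η = 2 ^ u`. Multisets
modulo equal action form an abelian group in bijection with the permutation group `G` (the
permutation brace). `G` is a 2-group (`isPGroup_permGroup`), so it fixes a nontrivial class; this
class acts as an automorphism, hence as a translation, and so translation by `η` is an automorphism
(`half_automorphism`). If it also commuted with every `σ x`, then `σ η = σ 0` and `X` would be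
retractable.

Let `X` be irretractable of size at least 8. A central involution of `G` is affine, and must be a
reflection `y ↦ c - y` with `c` odd (`exists_central_reflection`). A central involution of `G`
modulo the permutations preserving every pair `{p, c - p}` gives a `G`-invariant matching of these
pairs. By `selector_eq` it is translation by `η`, which therefore commutes with `G` up to the
reflection, hence exactly (`half_commutes`): a contradiction. Sizes 2 and 4 are finite checks. -/

/-- The cycle set law for a family `σ` of permutations, where `x ∗ y = σ x y`. -/
def CycleLaw {α : Type*} (σ : α → Perm α) : Prop :=
  ∀ x y z, σ (σ x y) (σ x z) = σ (σ y x) (σ y z)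

/-- The permutation group of a family of permutations. -/
def permGroup {α : Type*} (σ : α → Perm α) : Subgroup (Perm α) :=
  Subgroup.closure (Set.range σ)

theorem mem_permGroup_self {α : Type*} (σ : α → Perm α) (x : α) : σ x ∈ permGroup σ :=
  Subgroup.subset_closure ⟨x, rfl⟩

/-- In a finite group, a set closed under products is closed under inverses. -/
theorem inv_mem_of_mul_mem {G : Type*} [Group G] [Finite G] {P : G → Prop} (h1 : P 1)
    (hmul : ∀ a b, P a → P b → P (a * b)) {a : G} (ha : P a) : P a⁻¹ := by
  have hpow : ∀ k : ℕ, P (a ^ k) := by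
    intro k
    induction k with
    | zero => simpa using h1
    | succ k ih => rw [pow_succ]; exact hmul _ _ ih ha
  convert! hpow (orderOf a - 1)
  rw [inv_eq_iff_mul_eq_one, ← pow_succ',
    Nat.sub_add_cancel (orderOf_pos a), pow_orderOf_eq_one]

/-! ### The permutation brace, through multisets of points -/

namespace CycleLaw

variable {α : Type*} {σ : α → Perm α}

/-- Exchanging two successive additions of points is exactly the cycle law; it makes the fold over a
multiset well defined. -/
theorem leftCommutative (h : CycleLaw σ) :
    LeftCommutative fun (x : α) (π : Perm α) => σ (π x) * π :=
  ⟨fun x y π => by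
    ext w
    simpa using h (π y) (π x) (π w)⟩

/-- The permutation attached to a multiset: adding a point `x` to `m` composes with `σ` at the
current position of `x`. -/
def act (h : CycleLaw σ) (m : Multiset α) : Perm α :=
  have := h.leftCommutative
  m.foldr (fun x π => σ (π x) * π) 1

@[simp] theorem act_zero (h : CycleLaw σ) : h.act 0 = 1 := rfl

theorem act_cons (h : CycleLaw σ) (x : α) (m : Multiset α) :
    h.act (x ::ₘ m) = σ (h.act m x) * h.act m := by
  have := h.leftCommutative
  exact Multiset.foldr_cons _ _ _ _

@[simp] theorem act_singleton (h : CycleLaw σ) (x : α) : h.act {x} = σ x := by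
  rw [← Multiset.cons_zero, act_cons, act_zero]; simp

/-- The cocycle identity of the brace: once `m` has acted, the points of `r` sit at their images
under `h.act m`. -/
theorem act_add (h : CycleLaw σ) (m r : Multiset α) : h.act (m + r) = h.act (r.map (h.act m)) * h.act m := by
  induction r using Multiset.induction_on with
  | empty => simp
  | cons x r ih =>
    rw [Multiset.add_cons, act_cons, ih, Multiset.map_cons, act_cons]
    simp [mul_assoc]

theorem act_mul_act (h : CycleLaw σ) (m r : Multiset α) :
    h.act r * h.act m = h.act (m + r.map (h.act m).symm) := by
  rw [act_add, Multiset.map_map]; simp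

theorem act_mem (h : CycleLaw σ) (m : Multiset α) : h.act m ∈ permGroup σ := by
  induction m using Multiset.induction_on with
  | empty => rw [act_zero]; exact one_mem _
  | cons x m ih =>
    rw [act_cons]
    exact mul_mem (mem_permGroup_self σ _) ih

theorem mem_permGroup [Finite α] (h : CycleLaw σ) {g : Perm α} :
    g ∈ permGroup σ ↔ ∃ m, h.act m = g := by
  refine ⟨fun hg => ?_, ?_⟩
  · have hmul : ∀ a b : Perm α, (∃ m, h.act m = a) → (∃ m, h.act m = b) → ∃ m, h.act m = a * b := by
      rintro _ _ ⟨r, rfl⟩ ⟨m, rfl⟩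
      exact ⟨_, (h.act_mul_act m r).symm⟩
    have h1 : ∃ m, h.act m = 1 := ⟨0, h.act_zero⟩
    induction hg using Subgroup.closure_induction with
    | mem x hx => obtain ⟨y, rfl⟩ := hx; exact ⟨{y}, by simp⟩
    | one => exact h1
    | mul x y _ _ hx hy => exact hmul _ _ hx hy
    | inv x _ hx => exact inv_mem_of_mul_mem (P := fun a => ∃ m, h.act m = a) h1 hmul hx
  · rintro ⟨m, rfl⟩
    exact h.act_mem m

/-- As `m + r = r + m`, the action of `m + r` depends on `r` only through `h.act r`. So `G` acts on
classes of multisets. -/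
theorem act_map_congr [Finite α] (h : CycleLaw σ) {g : Perm α} (hg : g ∈ permGroup σ)
    {r r' : Multiset α} (hr : h.act r = h.act r') : h.act (r.map g) = h.act (r'.map g) := by
  obtain ⟨m, rfl⟩ := h.mem_permGroup.1 hg
  have h1 : h.act (m + r) = h.act (m + r') := by
    rw [add_comm m r, add_comm m r', act_add, act_add, hr]
  rw [act_add, act_add] at h1
  exact mul_right_cancel h1

/-- A subgroup of the permutation group which is stable under the action on multisets (a left
ideal of the permutation brace) and fixes a point is trivial if the diagonal is a full cycle. -/
theorem eq_bot_of_fixed [Finite α] (h : CycleLaw σ)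
    (hcyc : ∀ s : Set α, s.Nonempty → (∀ y ∈ s, σ y y ∈ s) → s = Set.univ)
    {B : Subgroup (Perm α)} (hle : B ≤ permGroup σ)
    (hB : ∀ m, h.act m ∈ B → ∀ g ∈ permGroup σ, h.act (m.map g) ∈ B)
    {x : α} (hx : ∀ b ∈ B, b x = x) : B = ⊥ := by
  have key : ∀ y, (∀ b ∈ B, b y = y) → ∀ b ∈ B, b (σ y y) = σ y y := by
    intro y hy b hb
    have hconj : ∀ a ∈ B, σ y * a * (σ y)⁻¹ ∈ B := by
      intro a ha
      obtain ⟨r, rfl⟩ := h.mem_permGroup.1 (hle ha)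
      -- Evaluating `r + {y}` in both orders shows that `σ y` normalises `B`, so the fixed points of
      -- `B` are stable under the diagonal.
      have h1 : h.act (r + {y}) = σ y * h.act r := by
        rw [act_add]; simp [hy _ ha]
      have h2 : h.act ({y} + r) = h.act (r.map (σ y)) * σ y := by
        rw [act_add]; simp
      rw [add_comm, h2] at h1
      rw [← h1, mul_inv_cancel_right]
      exact hB r ha _ (mem_permGroup_self σ y)
    have hinv : ∀ a ∈ B, (σ y)⁻¹ * a * (σ y)⁻¹⁻¹ ∈ B :=
      inv_mem_of_mul_mem (P := fun c : Perm α => ∀ a ∈ B, c * a * c⁻¹ ∈ B)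
        (by simp) (fun c d hc hd a ha => by
          have := hc _ (hd a ha)
          simpa [mul_assoc] using this) hconj
    have := hy _ (hinv b hb)
    simp only [inv_inv, Perm.mul_apply, Perm.inv_eq_iff_eq] at this
    exact this
  have huniv := hcyc {y | ∀ b ∈ B, b y = y} ⟨x, hx⟩ key
  refine (Subgroup.eq_bot_iff_forall _).2 fun b hb => Perm.ext fun y => ?_
  have hy : y ∈ {y | ∀ b ∈ B, b y = y} := huniv ▸ Set.mem_univ y
  exact hy b hb

/-- Multisets are identified if they act by the same permutation. -/
def sameAct [Finite α] (h : CycleLaw σ) : AddCon (Multiset α) where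
  r m m' := h.act m = h.act m'
  iseqv := ⟨fun _ => rfl, fun h => h.symm, fun h h' => h.trans h'⟩
  add' := by
    intro m m' r r' hm hr
    show h.act (m + r) = h.act (m' + r')
    rw [act_add, act_add, ← hm, h.act_map_congr (h.act_mem m) hr]

theorem sameAct_iff [Finite α] (h : CycleLaw σ) {m m' : Multiset α} :
    (m : h.sameAct.Quotient) = m' ↔ h.act m = h.act m' :=
  AddCon.eq _

/-- The classes of multisets are in bijection with the permutation group. -/
noncomputable def quotientEquiv [Finite α] (h : CycleLaw σ) :
    h.sameAct.Quotient ≃ permGroup σ :=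
  Equiv.ofBijective
    (fun a => AddCon.liftOn a (fun m => ⟨h.act m, h.act_mem m⟩) fun _ _ hm => Subtype.ext hm) <| by
    constructor
    · intro a b
      induction a using AddCon.induction_on with | _ m =>
      induction b using AddCon.induction_on with | _ m' =>
      intro hm
      exact h.sameAct_iff.2 (congrArg Subtype.val hm)
    · rintro ⟨g, hg⟩
      obtain ⟨m, rfl⟩ := h.mem_permGroup.1 hg
      exact ⟨m, rfl⟩

instance [Finite α] (h : CycleLaw σ) : Finite h.sameAct.Quotient :=
  Finite.of_equiv _ h.quotientEquiv.symm

theorem add_left_cancel [Finite α] (h : CycleLaw σ) (a b c : h.sameAct.Quotient)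
    (habc : a + b = a + c) : b = c := by
  induction a using AddCon.induction_on with | _ m =>
  induction b using AddCon.induction_on with | _ r =>
  induction c using AddCon.induction_on with | _ r' =>
  rw [← AddCon.coe_add, ← AddCon.coe_add, sameAct_iff, act_add, act_add] at habc
  have h1 := h.act_map_congr (inv_mem (h.act_mem m)) (mul_right_cancel habc)
  rw [sameAct_iff]
  simpa [Multiset.map_map] using h1

/-- The classes of multisets form a finite abelian group. -/
@[reducible] noncomputable def addCommGroupQuotient [Finite α] (h : CycleLaw σ) :
    AddCommGroup h.sameAct.Quotient :=
  letI : AddLeftCancelMonoid h.sameAct.Quotient :=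
    { (inferInstance : AddCommMonoid h.sameAct.Quotient) with
      add_left_cancel := fun a b c habc => h.add_left_cancel a b c habc }
  { AddLeftCancelMonoid.addGroupOfFinite (G := h.sameAct.Quotient) with
    add_comm := add_comm }

end CycleLaw

/-! ### Torsion, the `p`-group property and invariant elements -/

namespace CycleLaw

variable {α : Type*} {σ : α → Perm α}

theorem act_nsmul_map [Finite α] (h : CycleLaw σ) {g : Perm α} (hg : g ∈ permGroup σ) (l : ℕ)
    {r : Multiset α} (hr : h.act (l • r) = 1) : h.act (l • r.map g) = 1 := by
  have h1 := h.act_map_congr hg (hr.trans h.act_zero.symm)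
  rwa [Multiset.map_nsmul, Multiset.map_zero, act_zero] at h1

/-- The permutations coming from multisets killed by `l`. -/
def torsionSubgroup [Finite α] (h : CycleLaw σ) (l : ℕ) : Subgroup (Perm α) :=
  have h1 : ∃ m, h.act m = 1 ∧ h.act (l • m) = 1 := ⟨0, by simp⟩
  have hmul : ∀ a b : Perm α, (∃ m, h.act m = a ∧ h.act (l • m) = 1) →
      (∃ m, h.act m = b ∧ h.act (l • m) = 1) → ∃ m, h.act m = a * b ∧ h.act (l • m) = 1 := by
    rintro _ _ ⟨r, rfl, hr⟩ ⟨m, rfl, hm⟩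
    refine ⟨_, (h.act_mul_act m r).symm, ?_⟩
    rw [nsmul_add, act_add, hm, mul_one, Perm.coe_one, Multiset.map_id]
    exact h.act_nsmul_map (inv_mem (h.act_mem m)) l hr
  { carrier := {g | ∃ m, h.act m = g ∧ h.act (l • m) = 1}
    one_mem' := h1
    mul_mem' := hmul _ _
    inv_mem' := inv_mem_of_mul_mem (P := fun g => ∃ m, h.act m = g ∧ h.act (l • m) = 1) h1 hmul }

/-- The subgroup has as many elements as the `l`-torsion of the abelian group of classes, whose
order is a power of `l` by Cauchy. -/
theorem isPGroup_torsionSubgroup [Finite α] (h : CycleLaw σ) (l : ℕ) [hl : Fact l.Prime] :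
    IsPGroup l (h.torsionSubgroup l) := by
  let _ := h.addCommGroupQuotient
  let Ω : AddSubgroup h.sameAct.Quotient := (nsmulAddMonoidHom l).ker
  have hmem : ∀ a, a ∈ Ω ↔ l • a = 0 := fun a => Iff.rfl
  have hnsmul : ∀ (k : ℕ) (m : Multiset α), k • (m : h.sameAct.Quotient) = (k • m : Multiset α) := by
    intro k m
    induction k with
    | zero => rw [zero_nsmul, zero_nsmul]; rfl
    | succ k ih => rw [succ_nsmul, succ_nsmul, ih]; rfl
  have hmem' : ∀ m : Multiset α, (m : h.sameAct.Quotient) ∈ Ω ↔ h.act (l • m) = 1 := by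
    intro m
    rw [hmem, hnsmul]
    exact h.sameAct_iff (m' := 0)
  have hcard : Nat.card Ω = Nat.card (h.torsionSubgroup l) := by
    refine Nat.card_eq_of_bijective
      (fun a : Ω => (⟨h.quotientEquiv a.1, ?_⟩ : h.torsionSubgroup l)) ⟨?_, ?_⟩
    · obtain ⟨a, ha⟩ := a
      induction a using AddCon.induction_on with | _ m =>
      exact ⟨m, rfl, (hmem' m).1 ha⟩
    · intro a b hab
      have := congrArg Subtype.val hab
      exact Subtype.ext (h.quotientEquiv.injective (Subtype.ext this))
    · rintro ⟨g, m, rfl, hm⟩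
      exact ⟨⟨m, (hmem' m).2 hm⟩, rfl⟩
  have hpow : Nat.card Ω = l ^ (Nat.card Ω).primeFactorsList.length := by
    refine Nat.eq_prime_pow_of_unique_prime_dvd Nat.card_pos.ne' fun {q} hq hdvd => ?_
    have := Fact.mk hq
    have := Fintype.ofFinite Ω
    obtain ⟨a, ha⟩ := exists_prime_addOrderOf_dvd_card (G := Ω) q (by rwa [← Nat.card_eq_fintype_card])
    have hla : l • a = 0 := Subtype.ext ((hmem a.1).1 a.2)
    have hql : q ∣ l := ha ▸ addOrderOf_dvd_of_nsmul_eq_zero hla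
    exact (Nat.prime_dvd_prime_iff_eq hq hl.out).1 hql
  exact IsPGroup.of_card (hcard.symm.trans hpow)

/-- If the diagonal is a full cycle on `p ^ v` points, the permutation group is a `p`-group. -/
theorem isPGroup_permGroup [Finite α] (h : CycleLaw σ) {p v : ℕ} (hp : p.Prime)
    (hcard : Nat.card α = p ^ v)
    (hcyc : ∀ s : Set α, s.Nonempty → (∀ y ∈ s, σ y y ∈ s) → s = Set.univ) :
    IsPGroup p (permGroup σ) := by
  let _ := h.addCommGroupQuotient
  have hpow : Nat.card (permGroup σ) = p ^ (Nat.card (permGroup σ)).primeFactorsList.length := by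
    refine Nat.eq_prime_pow_of_unique_prime_dvd Nat.card_pos.ne' fun {l} hl hdvd => ?_
    by_contra hne
    have := Fact.mk hl
    have hnd : ¬ l ∣ Nat.card α := fun hd => hne <|
      (Nat.prime_dvd_prime_iff_eq hl hp).1 (hl.dvd_of_dvd_pow (hcard ▸ hd))
    -- An `l`-group acting on a number of points prime to `l` has a fixed point, so the `l`-torsion
    -- is trivial, against Cauchy.
    obtain ⟨x, hx⟩ := (h.isPGroup_torsionSubgroup l).nonempty_fixed_point_of_prime_not_dvd_card α hnd
    have hle : h.torsionSubgroup l ≤ permGroup σ := by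
      rintro _ ⟨m, rfl, -⟩
      exact h.act_mem m
    have hbot : h.torsionSubgroup l = ⊥ := by
      refine h.eq_bot_of_fixed hcyc hle (fun m hm g hg => ?_) fun b hb => hx ⟨b, hb⟩
      obtain ⟨r, hr, hr'⟩ := hm
      exact ⟨r.map g, h.act_map_congr hg hr, h.act_nsmul_map hg l hr'⟩
    have := Fintype.ofFinite h.sameAct.Quotient
    obtain ⟨a, ha⟩ := exists_prime_addOrderOf_dvd_card (G := h.sameAct.Quotient) l
      (by rwa [← Nat.card_eq_fintype_card, Nat.card_congr h.quotientEquiv])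
    induction a using AddCon.induction_on with | _ m =>
    have hla : l • (m : h.sameAct.Quotient) = 0 := ha ▸ addOrderOf_nsmul_eq_zero _
    have hnsmul : ∀ k : ℕ, k • (m : h.sameAct.Quotient) = (k • m : Multiset α) := by
      intro k
      induction k with
      | zero => rw [zero_nsmul, zero_nsmul]; rfl
      | succ k ih => rw [succ_nsmul, succ_nsmul, ih]; rfl
    rw [hnsmul] at hla
    have hm : h.act m ∈ h.torsionSubgroup l := ⟨m, rfl, (h.sameAct_iff (m' := 0)).1 hla⟩
    rw [hbot, Subgroup.mem_bot] at hm
    have hm0 : (m : h.sameAct.Quotient) = 0 := (h.sameAct_iff (m' := 0)).2 hm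
    rw [hm0, addOrderOf_zero] at ha
    exact hl.one_lt.ne ha
  exact IsPGroup.of_card hpow

/-- A nontrivial permutation `p`-group contains a nontrivial element `h.act r` which is invariant
under the action of the group on multisets. -/
theorem exists_invariant [Finite α] (h : CycleLaw σ) {p : ℕ} [Fact p.Prime]
    (hp : IsPGroup p (permGroup σ)) [hnt : Nontrivial (permGroup σ)] :
    ∃ r, h.act r ≠ 1 ∧ ∀ g ∈ permGroup σ, h.act (r.map g) = h.act r := by
  let _ : MulAction (permGroup σ) h.sameAct.Quotient :=
    { smul := fun g a => AddCon.liftOn a (fun m => ((m.map g.1 : Multiset α) : h.sameAct.Quotient))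
        fun _ _ hm => h.sameAct_iff.2 (h.act_map_congr g.2 hm)
      one_smul := by
        intro a
        induction a using AddCon.induction_on with | _ m =>
        exact congrArg _ (Multiset.map_id m)
      mul_smul := by
        intro g g' a
        induction a using AddCon.induction_on with | _ m =>
        exact congrArg _ (Multiset.map_map g.1 g'.1 m).symm }
  have hsmul : ∀ (g : permGroup σ) (m : Multiset α),
      g • (m : h.sameAct.Quotient) = ((m.map g.1 : Multiset α) : h.sameAct.Quotient) :=
    fun _ _ => rfl
  have hdvd : p ∣ Nat.card h.sameAct.Quotient := by
    rw [Nat.card_congr h.quotientEquiv]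
    refine hp.card_eq_or_dvd.resolve_left fun h1 => ?_
    have := (Nat.card_eq_one_iff_unique.1 h1).1
    exact not_subsingleton (permGroup σ) this
  -- The zero class is fixed and `p` divides the number of classes, so a second class is fixed.
  obtain ⟨b, hb, hne⟩ := hp.exists_fixed_point_of_prime_dvd_card_of_fixed_point
    h.sameAct.Quotient hdvd (a := 0) (fun g => hsmul g 0)
  induction b using AddCon.induction_on with | _ r =>
  refine ⟨r, fun hr => hne ?_, fun g hg => ?_⟩
  · exact ((h.sameAct_iff (m' := 0)).2 hr).symm
  · exact h.sameAct_iff.1 (hb ⟨g, hg⟩)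

/-- An invariant element acts as an automorphism. -/
theorem conj_eq_of_invariant [Finite α] (h : CycleLaw σ) {r : Multiset α}
    (hr : ∀ g ∈ permGroup σ, h.act (r.map g) = h.act r) (x y : α) :
    h.act r (σ x y) = σ (h.act r x) (h.act r y) := by
  have h1 : h.act (r + {x}) = σ (h.act r x) * h.act r := by rw [act_add]; simp
  have h2 : h.act ({x} + r) = h.act r * σ x := by
    rw [act_add, act_singleton, hr _ (mem_permGroup_self σ x)]
  rw [add_comm, h2] at h1
  exact DFunLike.congr_fun h1 y

end CycleLaw

/-! ### Arithmetic modulo `2 ^ (u + 1)` -/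

namespace TwoPowMod

variable {u : ℕ}

/-- Induction along the single cycle of `T`, from an arbitrary starting point. -/
theorem induction {P : ZMod (2 ^ (u + 1)) → Prop} (h0 : ∃ k, P k) (h1 : ∀ k, P k → P (k + 1)) (k) :
    P k := by
  obtain ⟨a, ha⟩ := h0
  have key : ∀ j : ℕ, P (a + j) := by
    intro j
    induction j with
    | zero => simpa using ha
    | succ j ih => rw [Nat.cast_succ, ← add_assoc]; exact h1 _ ih
  have := key (k - a).val
  rwa [ZMod.natCast_zmod_val, add_sub_cancel] at this

theorem two_pow_eq_zero : (2 : ZMod (2 ^ (u + 1))) ^ (u + 1) = 0 := by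
  have := ZMod.natCast_self (2 ^ (u + 1))
  push_cast at this
  exact this

theorem half_ne_zero : (2 : ZMod (2 ^ (u + 1))) ^ u ≠ 0 := by
  have h := (ZMod.natCast_eq_zero_iff (2 ^ u) (2 ^ (u + 1))).not.2
    fun hd => absurd (Nat.le_of_dvd (by positivity) hd) (by rw [pow_succ]; have := Nat.two_pow_pos u; omega)
  push_cast at h
  exact h

theorem half_add_half : (2 : ZMod (2 ^ (u + 1))) ^ u + 2 ^ u = 0 := by
  rw [← two_mul, ← pow_succ', two_pow_eq_zero]

theorem eq_zero_or_eq_half {a : ZMod (2 ^ (u + 1))} (ha : 2 * a = 0) : a = 0 ∨ a = 2 ^ u := by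
  have h1 : ((2 * a.val : ℕ) : ZMod (2 ^ (u + 1))) = 0 := by
    push_cast; rw [ZMod.natCast_zmod_val, ha]
  have h2 : 2 ^ u ∣ a.val := Nat.dvd_of_mul_dvd_mul_left two_pos <| by
    have := (ZMod.natCast_eq_zero_iff _ _).1 h1
    exact (pow_succ' 2 u).symm.dvd.trans this
  obtain ⟨k, hk⟩ := h2
  have hk2 : k < 2 := Nat.lt_of_mul_lt_mul_left (a := 2 ^ u) <|
    calc 2 ^ u * k = a.val := hk.symm
      _ < 2 ^ (u + 1) := ZMod.val_lt a
      _ = 2 ^ u * 2 := pow_succ 2 u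
  have ha' : a = ((2 ^ u * k : ℕ) : ZMod (2 ^ (u + 1))) := by rw [← hk, ZMod.natCast_zmod_val]
  interval_cases k
  · left; simpa using ha'
  · right; rw [ha']; push_cast; ring

theorem even_or_odd (a : ZMod (2 ^ (u + 1))) : Even a ∨ Odd a := by
  rw [← ZMod.natCast_zmod_val a]
  exact (Nat.even_or_odd a.val).imp (fun h => h.natCast) (fun h => h.natCast)

theorem not_even_of_odd {a : ZMod (2 ^ (u + 1))} (ho : Odd a) : ¬ Even a := by
  intro he
  have hd : 2 ∣ 2 ^ (u + 1) := dvd_pow_self 2 (by omega)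
  have h1 := he.map (ZMod.castHom hd (ZMod 2))
  have h2 := ho.map (ZMod.castHom hd (ZMod 2))
  generalize ZMod.castHom hd (ZMod 2) a = b at h1 h2
  obtain ⟨x, rfl⟩ := h1
  obtain ⟨y, hy⟩ := h2
  revert x y
  decide

theorem half_mul_even {a : ZMod (2 ^ (u + 1))} (ha : Even a) : 2 ^ u * a = 0 := by
  obtain ⟨b, rfl⟩ := ha
  rw [mul_add, ← add_mul, half_add_half, zero_mul]

theorem half_mul_odd {a : ZMod (2 ^ (u + 1))} (ha : Odd a) : 2 ^ u * a = 2 ^ u := by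
  obtain ⟨b, rfl⟩ := ha
  rw [mul_add, half_mul_even (even_two_mul b), zero_add, mul_one]

theorem isUnit_of_odd {a : ZMod (2 ^ (u + 1))} (ha : Odd a) : IsUnit a := by
  obtain ⟨b, rfl⟩ := ha
  have : IsNilpotent (2 * b) := ⟨u + 1, by rw [mul_pow, two_pow_eq_zero, zero_mul]⟩
  exact this.isUnit_add_one

/-- Writing `r = 2 * b + 1` gives `4 * b * (b + 1) = 0`, and one of `b`, `b + 1` is odd, hence a
unit. -/
theorem sq_eq_one {r : ZMod (2 ^ (u + 1))} (hr : r * r = 1) :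
    r = 1 ∨ r = -1 ∨ r = 1 + 2 ^ u ∨ r = -1 + 2 ^ u := by
  have ho : Odd r := (even_or_odd r).resolve_left fun he =>
    not_even_of_odd odd_one (hr ▸ he.mul_left r)
  obtain ⟨b, rfl⟩ := ho
  have h4 : (2 * (2 * b)) * (b + 1) = 0 := by linear_combination hr
  rcases even_or_odd b with hb | hb
  · rw [(isUnit_of_odd hb.add_one).mul_left_eq_zero] at h4
    rcases eq_zero_or_eq_half h4 with h | h
    · left; linear_combination h
    · right; right; left; linear_combination h
  · have h5 : (2 * (2 * (b + 1))) * b = 0 := by linear_combination h4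
    rw [(isUnit_of_odd hb).mul_left_eq_zero] at h5
    rcases eq_zero_or_eq_half h5 with h | h
    · right; left; linear_combination h
    · right; right; right; linear_combination h

theorem exists_nsmul_eq_half {c : ZMod (2 ^ (u + 1))} (hc : c ≠ 0) : ∃ j : ℕ, j * c = 2 ^ u := by
  classical
  have hex : ∃ i : ℕ, 2 ^ i * c = 0 := ⟨u + 1, by rw [two_pow_eq_zero, zero_mul]⟩
  obtain ⟨i, hi⟩ : ∃ i, Nat.find hex = i + 1 := Nat.exists_eq_succ_of_ne_zero fun h0 => hc <| by
    simpa [h0] using Nat.find_spec hex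
  have h1 : 2 * (2 ^ i * c) = 0 := by
    have := Nat.find_spec hex
    rw [hi] at this
    linear_combination this
  have h2 : (2 : ZMod (2 ^ (u + 1))) ^ i * c ≠ 0 := Nat.find_min hex (by omega)
  exact ⟨2 ^ i, by push_cast; exact (eq_zero_or_eq_half h1).resolve_left h2⟩

/-! ### Translation by half the size -/

variable {σ : ZMod (2 ^ (u + 1)) → Perm (ZMod (2 ^ (u + 1)))}

theorem isPGroup (h : CycleLaw σ) (hd : ∀ x, σ x x = x + 1) : IsPGroup 2 (permGroup σ) := by
  refine h.isPGroup_permGroup (v := u + 1) Nat.prime_two (Nat.card_zmod _) fun s hs hs' => ?_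
  refine Set.eq_univ_of_forall (induction hs fun k hk => ?_)
  rw [← hd k]
  exact hs' k hk

theorem nontrivial_permGroup (hd : ∀ x, σ x x = x + 1) : Nontrivial (permGroup σ) := by
  refine ⟨⟨σ 0, mem_permGroup_self σ 0⟩, 1, fun h => ?_⟩
  have h0 := hd 0
  rw [show σ 0 = 1 from congrArg Subtype.val h] at h0
  refine half_ne_zero (u := u) ?_
  rw [← mul_one (2 ^ u), ← zero_add (1 : ZMod (2 ^ (u + 1))), ← h0]
  simp

/-- Translation by half the size is an automorphism. -/
theorem half_automorphism (h : CycleLaw σ) (hd : ∀ x, σ x x = x + 1) (x y) :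
    σ (x + 2 ^ u) (y + 2 ^ u) = σ x y + 2 ^ u := by
  have := nontrivial_permGroup hd
  have := Fact.mk Nat.prime_two
  obtain ⟨r, hr1, hr⟩ := h.exists_invariant (isPGroup h hd)
  have haut := h.conj_eq_of_invariant hr
  set t := h.act r
  -- An automorphism commutes with the diagonal `k ↦ k + 1`, so it is a translation.
  have ht : ∀ k, t k = k + t 0 := induction ⟨0, by simp⟩ fun k hk => by
    rw [← hd k, haut, hd, hd, hk]; ring
  have hc : t 0 ≠ 0 := fun h0 => hr1 <| Perm.ext fun k => by rw [ht, h0]; simp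
  obtain ⟨j, hj⟩ := exists_nsmul_eq_half hc
  have key : ∀ (i : ℕ) x y, σ (x + i * t 0) (y + i * t 0) = σ x y + i * t 0 := by
    intro i
    induction i with
    | zero => simp
    | succ i ih =>
      intro x y
      have e : ∀ a, a + ((i + 1 : ℕ) : ZMod (2 ^ (u + 1))) * t 0 = t (a + i * t 0) := by
        intro a; rw [ht (a + _)]; push_cast; ring
      rw [e, e, e, ← haut, ih]
  have := key j x y
  rwa [hj] at this

end TwoPowMod

/-! ### Central involutions of the permutation group and of a quotient -/

theorem IsPGroup.exists_central_pow_eq_one {p : ℕ} [Fact p.Prime] {Q : Type*} [Group Q] [Finite Q]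
    [Nontrivial Q] (hQ : IsPGroup p Q) : ∃ c : Q, c ≠ 1 ∧ c ^ p = 1 ∧ ∀ g, g * c = c * g := by
  have := hQ.center_nontrivial
  obtain ⟨n, hn⟩ := IsPGroup.iff_card.1 (hQ.to_subgroup (Subgroup.center Q))
  have hn0 : n ≠ 0 := by
    rintro rfl
    rw [pow_zero] at hn
    exact Finite.one_lt_card.ne' hn
  obtain ⟨c, hc⟩ := exists_prime_orderOf_dvd_card' (G := Subgroup.center Q) p
    (hn ▸ dvd_pow_self p hn0)
  refine ⟨c.1, fun h1 => ?_, ?_, Subgroup.mem_center_iff.1 c.2⟩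
  · rw [show c = 1 from Subtype.ext h1, orderOf_one] at hc
    exact (Fact.out : p.Prime).one_lt.ne hc
  · exact congrArg Subtype.val (hc ▸ pow_orderOf_eq_one c)

namespace TwoPowMod

variable {u : ℕ} {σ : ZMod (2 ^ (u + 1)) → Perm (ZMod (2 ^ (u + 1)))}

theorem exists_even_two_mul_eq_half (hu : 2 ≤ u) :
    ∃ m : ZMod (2 ^ (u + 1)), Even m ∧ 2 * m = 2 ^ u := by
  obtain ⟨k, rfl⟩ := Nat.exists_eq_add_of_le hu
  exact ⟨2 * 2 ^ k, even_two_mul _, by ring⟩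

theorem even_half (hu : 2 ≤ u) : Even ((2 : ZMod (2 ^ (u + 1))) ^ u) := by
  obtain ⟨m, -, hm⟩ := exists_even_two_mul_eq_half hu
  exact hm ▸ even_two_mul m

theorem four_ne_zero (hu : 2 ≤ u) : (4 : ZMod (2 ^ (u + 1))) ≠ 0 := by
  intro h4
  obtain ⟨k, rfl⟩ := Nat.exists_eq_add_of_le hu
  refine half_ne_zero (u := 2 + k) ?_
  linear_combination 2 ^ k * h4

theorem two_ne_zero (hu : 2 ≤ u) : (2 : ZMod (2 ^ (u + 1))) ≠ 0 := fun h2 =>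
  four_ne_zero hu (by linear_combination 2 * h2)

/-- A central involution is a reflection, unless it is the translation by half the size. -/
theorem exists_central_reflection (hu : 2 ≤ u) (h : CycleLaw σ) (hd : ∀ x, σ x x = x + 1)
    (hbad : ¬ ∀ x y, σ x (y + 2 ^ u) = σ x y + 2 ^ u) :
    ∃ c, Odd c ∧ ∀ g ∈ permGroup σ, ∀ y, g (c - y) = c - g y := by
  have := nontrivial_permGroup hd
  have := Fact.mk Nat.prime_two
  obtain ⟨⟨z, hz⟩, hz1, hz2, hzc⟩ := (isPGroup h hd).exists_central_pow_eq_one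
  replace hz1 : z ≠ 1 := fun h => hz1 (Subtype.ext h)
  replace hz2 : ∀ y, z (z y) = y := fun y => by
    have := DFunLike.congr_fun (congrArg Subtype.val hz2) y
    simpa [pow_two] using this
  replace hzc : ∀ g ∈ permGroup σ, ∀ y, g (z y) = z (g y) := fun g hg y =>
    DFunLike.congr_fun (congrArg Subtype.val (hzc ⟨g, hg⟩)) y
  have hσ : ∀ x y, σ x (z y) = z (σ x y) := fun x => hzc _ (mem_permGroup_self σ x)
  have hfix : ∀ p, z p ≠ p := fun p hp => hz1 <| Perm.ext <| induction ⟨p, hp⟩ fun k hk => by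
    show z (k + 1) = k + 1
    rw [← hd, ← hσ, show z k = k from hk]
  -- `z (z p + 1)` equals `σ (z p) p`, whose displacement from `p` is constant along the cycle by
  -- the cycle law. At `p = z k` this reads `z (k + 1) = z k + r`, so `z` is affine.
  have hf : ∀ p, z (z p + 1) = p + z (z 0 + 1) := induction ⟨0, by simp⟩ fun p hp => by
    have e : ∀ q, z (z q + 1) = σ (z q) q := fun q => by rw [← hd (z q), ← hσ, hz2]
    rw [e] at hp
    rw [e, ← hd p, ← hσ, h, hd, hd, hp]
    ring
  set r := z (z 0 + 1)
  have hzr : ∀ k, z k = z 0 + r * k := induction ⟨0, by simp⟩ fun k hk => by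
    have := hf (z k)
    rw [hz2] at this
    rw [this, hk]; ring
  set c := z 0
  have h0 : r * c + c = 0 := by
    have := hz2 0
    rw [hzr, hzr] at this
    linear_combination this
  have h1 : r * r = 1 := by
    have := hz2 1
    rw [hzr, hzr] at this
    linear_combination this - h0
  obtain ⟨m, hm, hm2⟩ := exists_even_two_mul_eq_half hu
  rcases sq_eq_one h1 with hr | hr | hr | hr
  · rw [hr] at h0 hzr
    rcases eq_zero_or_eq_half (by linear_combination h0) with hc | hc
    · exact absurd (by rw [hzr, hc]; ring) (hfix 0)
    · refine absurd (fun x y => ?_) hbad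
      have := hσ x y
      rw [hzr, hzr, hc] at this
      rw [add_comm y, add_comm (σ x y)]
      simpa using this
  · have hzc' : ∀ k, z k = c - k := fun k => by rw [hzr, hr]; ring
    refine ⟨c, (even_or_odd c).resolve_left ?_, fun g hg y => by
      rw [← hzc', ← hzc', hzc g hg]⟩
    rintro ⟨b, hb⟩
    exact hfix b (by rw [hzc', hb]; ring)
  -- For the slopes `±1 + 2 ^ u`, the parity of the constant term yields a fixed point or a
  -- contradiction.
  · exfalso
    rw [hr] at h0 hzr
    rcases even_or_odd c with hc | hc
    · have h2 := half_mul_even hc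
      rcases eq_zero_or_eq_half (a := c) (by linear_combination h0 - h2) with hc | hc
      · exact hfix 0 (by rw [hzr, hc]; ring)
      · exact hfix 1 (by rw [hzr, hc]; linear_combination half_add_half (u := u))
    · have h2 := half_mul_odd hc
      have : 2 * (c + m) = 0 := by linear_combination h0 - h2 + hm2
      refine not_even_of_odd (hc.add_even hm) ?_
      rcases eq_zero_or_eq_half this with h | h
      · rw [h]; exact Even.zero
      · rw [h]; exact even_half hu
  · exfalso
    rw [hr] at h0 hzr
    rcases even_or_odd c with ⟨b, hb⟩ | hc
    · rcases even_or_odd b with hb2 | hb2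
      · have := half_mul_even hb2
        exact hfix b (by rw [hzr, hb]; linear_combination this)
      · have := half_mul_odd (hb2.add_even hm)
        exact hfix (b + m) (by rw [hzr, hb]; linear_combination this - hm2)
    · have h2 := half_mul_odd hc
      exact half_ne_zero (u := u) (by linear_combination h0 - h2)

/-- The permutation group has an element which is not a local reflection, but is central and an
involution up to local reflections. -/
theorem exists_almost_central (hu : 2 ≤ u) (h : CycleLaw σ) (hd : ∀ x, σ x x = x + 1)
    {c : ZMod (2 ^ (u + 1))} (hc : ∀ g ∈ permGroup σ, ∀ y, g (c - y) = c - g y) :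
    ∃ w : Perm (ZMod (2 ^ (u + 1))),
      (∀ x y, w (σ x y) = σ x (w y) ∨ w (σ x y) = c - σ x (w y)) ∧
      (∀ p, w (w p) = p ∨ w (w p) = c - p) ∧ (∀ p, w p ≠ p ∧ w p ≠ c - p) ∧
      ∀ p, w (c - p) = c - w p := by
  have := Fact.mk Nat.prime_two
  let M : Subgroup (permGroup σ) :=
    { carrier := {g | ∀ p, g.1 p = p ∨ g.1 p = c - p}
      one_mem' := fun p => Or.inl rfl
      mul_mem' := by
        intro a b ha hb p
        have h1 : (a * b).1 p = a.1 (b.1 p) := rfl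
        rw [h1]
        rcases hb p with hb | hb <;> rw [hb]
        · exact ha p
        · rw [hc _ a.2]
          rcases ha p with ha | ha <;> rw [ha] <;> simp
      inv_mem' := by
        intro a ha p
        have h1 : a.1 (a⁻¹.1 p) = p := Equiv.apply_symm_apply _ _
        rcases ha (a⁻¹.1 p) with ha | ha
        · left; rw [← ha, h1]
        · right; rw [h1] at ha; linear_combination ha }
  have hM : ∀ g, g ∈ M ↔ ∀ p, g.1 p = p ∨ g.1 p = c - p := fun g => Iff.rfl
  have hnormal : M.Normal := by
    refine ⟨fun a ha g p => ?_⟩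
    have h1 : g.1 (g⁻¹.1 p) = p := Equiv.apply_symm_apply _ _
    have h2 : (g * a * g⁻¹).1 p = g.1 (a.1 (g⁻¹.1 p)) := rfl
    rw [h2]
    rcases ha (g⁻¹.1 p) with ha | ha <;> rw [ha]
    · left; exact h1
    · right; rw [hc _ g.2, h1]
  -- If all of `G` preserved the pairs `{p, c - p}`, then `x + 1 = c - x` for every `x`.
  have hnt : Nontrivial (permGroup σ ⧸ M) := by
    rw [QuotientGroup.nontrivial_iff]
    intro htop
    have hall : ∀ x y, σ x y = y ∨ σ x y = c - y := fun x =>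
      (hM ⟨σ x, mem_permGroup_self σ x⟩).1 (htop ▸ Subgroup.mem_top _)
    have h1 : (1 : ZMod (2 ^ (u + 1))) ≠ 0 := fun h => two_ne_zero hu (by linear_combination 2 * h)
    have hx : ∀ x, x + 1 = c - x := fun x => by
      rw [← hd]
      refine (hall x x).resolve_left fun h => h1 ?_
      rw [hd] at h
      linear_combination h
    exact two_ne_zero hu (by linear_combination hx 1 - hx 0)
  obtain ⟨w', hw1, hw2, hwc⟩ := ((isPGroup h hd).to_quotient M).exists_central_pow_eq_one
  obtain ⟨w, rfl⟩ := QuotientGroup.mk_surjective w'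
  rw [Ne, QuotientGroup.eq_one_iff] at hw1
  rw [← QuotientGroup.mk_pow, QuotientGroup.eq_one_iff, hM] at hw2
  have hcomm : ∀ x y, w.1 (σ x y) = σ x (w.1 y) ∨ w.1 (σ x y) = c - σ x (w.1 y) := by
    intro x y
    let g : permGroup σ := ⟨σ x, mem_permGroup_self σ x⟩
    have h1 := hwc (QuotientGroup.mk g)
    rw [← QuotientGroup.mk_mul, ← QuotientGroup.mk_mul, QuotientGroup.eq, hM] at h1
    have h2 : σ x (w.1 (((g * w)⁻¹ * (w * g)).1 y)) = w.1 (σ x y) := by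
      have : g * w * ((g * w)⁻¹ * (w * g)) = w * g := by group
      exact DFunLike.congr_fun (congrArg Subtype.val this) y
    rw [← h2]
    rcases h1 y with h1 | h1 <;> rw [h1]
    · left; rfl
    · right; rw [hc _ w.2, hc _ g.2]
  refine ⟨w.1, hcomm, fun p => ?_, ?_, hc _ w.2⟩
  · have := hw2 p
    rwa [pow_two] at this
  · have : ¬ ∃ p, w.1 p = p ∨ w.1 p = c - p := fun hp => hw1 <| (hM w).2 <|
      induction hp fun k hk => by
        have hck := hc _ (mem_permGroup_self σ k) k
        have h2 := hcomm k k
        rw [hd] at h2 hck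
        rcases hk with hk | hk <;> rw [hk] at h2
        · rwa [hd] at h2
        · rw [hck, sub_sub_cancel] at h2
          exact h2.symm
    exact fun p => not_or.1 fun hp => this ⟨p, hp⟩

end TwoPowMod

/-! ### Retractability for sizes at least 8 -/

namespace TwoPowMod

variable {u : ℕ} {σ : ZMod (2 ^ (u + 1)) → Perm (ZMod (2 ^ (u + 1)))}

/-- The displacement `σ q p - p` is unchanged when `(p, q)` moves to `(p + 1, σ p q)`. -/
theorem law_diag (h : CycleLaw σ) (hd : ∀ x, σ x x = x + 1) (p q) :
    σ (σ p q) (p + 1) = σ q p + 1 := by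
  rw [← hd p, h, hd]

/-- If translation by half the size commutes with the permutation group up to a reflection, then it
commutes with it. -/
theorem half_commutes (hu : 2 ≤ u) (h : CycleLaw σ) (hd : ∀ x, σ x x = x + 1)
    {c : ZMod (2 ^ (u + 1))} (hodd : Odd c) (hc : ∀ x y, σ x (c - y) = c - σ x y)
    (hA : ∀ x y, σ x (y + 2 ^ u) = σ x y + 2 ^ u ∨ σ x (y + 2 ^ u) = c - (σ x y + 2 ^ u))
    (hB : ∀ p, σ p (p + 2 ^ u) = p + 1 + 2 ^ u) (x y) :
    σ x (y + 2 ^ u) = σ x y + 2 ^ u := by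
  set η : ZMod (2 ^ (u + 1)) := 2 ^ u
  have hη : η + η = 0 := half_add_half
  have hneven : ∀ b, c ≠ 2 * b := fun b hb => not_even_of_odd hodd (hb ▸ even_two_mul b)
  have hη' : ∀ a, a + η + η = a := fun a => by rw [add_assoc, hη, add_zero]
  have hshift : ∀ x y, σ (x + η) y = σ x (y + η) + η := fun x y => by
    rw [← half_automorphism h hd, hη']
  -- The pairs at which commutation fails; the alternatives of `hA` are exclusive since `c` is odd.
  -- Badness turns out to be symmetric, stable under reflecting the second entry, and carried along
  -- by the motion in `law_diag`.
  let bad : ZMod (2 ^ (u + 1)) → ZMod (2 ^ (u + 1)) → Prop :=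
    fun x y => σ x (y + η) = c - (σ x y + η)
  have hbad : ∀ x y, bad x y → σ (x + η) y = c - σ x y := fun x y hxy => by
    rw [hshift, show σ x (y + η) = _ from hxy]; ring
  have hsymm : ∀ p q, bad q p → bad p q := by
    intro p q hqp
    refine (hA p q).resolve_left fun hpq => ?_
    have h1 := law_diag h hd p (q + η)
    rw [hpq, hbad q p hqp] at h1
    have h2 := law_diag h hd p q
    rw [hshift] at h1
    rcases hA (σ p q) (p + 1) with h3 | h3
    · rw [h3, h2] at h1
      exact hneven (σ q p) (by linear_combination hη - h1)
    · rw [h3, h2] at h1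
      exact two_ne_zero hu (by linear_combination -h1)
  have hrefl : ∀ p q, bad p q → bad p (c - q) := by
    intro p q hpq
    have h1 := hc p (q + η)
    rw [show c - (q + η) = c - q + η by linear_combination -hη,
      show σ p (q + η) = _ from hpq] at h1
    show σ p (c - q + η) = c - (σ p (c - q) + η)
    rw [h1, hc]
    linear_combination hη
  have hmove : ∀ p q, bad q p → bad (σ p q) (p + 1) := by
    intro p q hqp
    show σ (σ p q) (p + 1 + η) = c - (σ (σ p q) (p + 1) + η)
    rw [← hB, h, show σ q (p + η) = _ from hqp, hc, hB, law_diag h hd]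
  have hkey : ∀ p q, bad q p → σ (c - q) p = σ q p - 2 := by
    intro p q hqp
    have hpq := hsymm _ _ hqp
    have h1 := law_diag h hd p (q + η)
    rw [show σ p (q + η) = _ from hpq, hbad q p hqp,
      show c - (σ p q + η) = c - σ p q + η by linear_combination -hη,
      hbad _ _ (hsymm _ _ (hrefl _ _ (hsymm _ _ (hmove p q hqp)))), ← hc p q, law_diag h hd] at h1
    linear_combination -h1
  refine (hA x y).resolve_right fun hxy => ?_
  -- Going from `x` to `c - x` and back lowers the value by 2 each time, so `4 = 0`.
  have h1 := hkey y x hxy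
  have h2 := hkey y (c - x) (hsymm _ _ (hrefl _ _ (hsymm _ _ hxy)))
  rw [sub_sub_cancel] at h2
  exact four_ne_zero hu (by linear_combination h1 + h2)

/-- Let `R` be a relation invariant under the permutations, relating each point to a pair
`{q, c - q}`. A function selecting from each pair the point `s p` with `σ (s p) p = p + g` is the
translation by half the size, up to the reflection `y ↦ c - y`. -/
theorem selector_eq (hu : 2 ≤ u) (h : CycleLaw σ) (hd : ∀ x, σ x x = x + 1)
    {c : ZMod (2 ^ (u + 1))} (hodd : Odd c)
    {R : ZMod (2 ^ (u + 1)) → ZMod (2 ^ (u + 1)) → Prop}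
    (hRσ : ∀ x p q, R p q → R (σ x p) (σ x q)) (hRc : ∀ p q, R p q → R (c - p) (c - q))
    (hRp : ∀ p q, R p q → q ≠ p ∧ q ≠ c - p)
    (hRR : ∀ p q q', R p q → R q q' → q' = p ∨ q' = c - p)
    (hRq : ∀ p q q', R p q → R p q' → q' = q ∨ q' = c - q)
    {g : ZMod (2 ^ (u + 1))} (hg : 2 * g ≠ 0) {s : ZMod (2 ^ (u + 1)) → ZMod (2 ^ (u + 1))}
    (hs : ∀ p, R p (s p)) (hsg : ∀ p, σ (s p) p = p + g) (hsg' : ∀ p, σ (c - s p) p = p - g)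
    (hc : ∀ x y, σ x (c - y) = c - σ x y) :
    (∀ p, s (p + 1) = σ p (s p)) ∧
      ((∀ p, s p = p + 2 ^ u) ∨ ∀ p, s p = c - (p + 2 ^ u)) := by
  -- The other point of the pair has displacement `-g`, which differs from `g`. Uniqueness makes `s`
  -- commute with `T` and with the reflection.
  have huniq : ∀ p q, R p q → σ q p = p + g → q = s p := fun p q hpq hq => by
    refine (hRq p _ _ (hs p) hpq).resolve_right fun h1 => hg ?_
    rw [h1, hsg'] at hq
    linear_combination -hq
  have hs1 : ∀ p, s (p + 1) = σ p (s p) := fun p => Eq.symm <| huniq _ _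
    (hd p ▸ hRσ p _ _ (hs p)) (by rw [law_diag h hd, hsg]; ring)
  have hsc : ∀ p, s (c - p) = c - s p := fun p => Eq.symm <| huniq _ _ (hRc _ _ (hs p))
    (by rw [hc, hsg']; ring)
  have hRs : ∀ p, R (p + g) (s p + 1) := fun p => by
    have := hRσ (s p) _ _ (hs p)
    rwa [hd, hsg] at this
  have he : ∀ p, σ (s p + 1) (p + g) = p + σ (s 0 + 1) (0 + g) := by
    refine induction ⟨0, by simp only [zero_add]⟩ fun p hp => ?_
    have h1 : s (p + 1) + 1 = σ (p + g) (s p + 1) := by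
      rw [← hd (s (p + 1)), hs1, h p, hsg, hd]
    rw [h1, show p + 1 + g = p + g + 1 by ring, law_diag h hd, hp]
    ring
  -- The constant in `he` decides between `s p + 1` being `s (p + g)` or its reflection, uniformly
  -- in `p`; the second option, applied at `0` and at `c - g`, gives `2 = 0`.
  have hstep : ∀ p, s (p + g) = s p + 1 := by
    rcases hRq _ _ _ (hs (0 + g)) (hRs 0) with h0 | h0
    · rw [h0, hsg] at he
      exact fun p => Eq.symm <| huniq _ _ (hRs p) (by rw [he]; ring)
    · rw [h0, hsg'] at he
      have hstep : ∀ p, s p + 1 = c - s (p + g) := fun p =>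
        (hRq _ _ _ (hs _) (hRs p)).resolve_left fun h1 => hg <| by
          have := he p
          rw [h1, hsg] at this
          linear_combination this
      have h1 := hstep (c - (0 + g))
      rw [show c - (0 + g) + g = c - 0 by ring, hsc, hsc] at h1
      exact absurd (by linear_combination h1 + h0) (two_ne_zero hu)
  have hiter : ∀ k : ℕ, s (k * g) = s 0 + k := by
    intro k
    induction k with
    | zero => simp
    | succ k ih => rw [show ((k + 1 : ℕ) : ZMod (2 ^ (u + 1))) * g = k * g + g by push_cast; ring,
        hstep, ih]; push_cast; ring
  have hiter' : ∀ k, s (k * g) = s 0 + k := fun k => by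
    have := hiter k.val
    rwa [ZMod.natCast_zmod_val] at this
  -- Multiplication by `g` is injective because `s (k * g)` determines `k`; so `g` is a unit and `s`
  -- is affine with slope `g⁻¹`.
  obtain ⟨r, hr⟩ : ∃ r, r * g = 1 := by
    refine (Finite.injective_iff_surjective.1 fun k k' hk => ?_ : Function.Surjective (· * g)) 1
    have := (hiter' k).symm.trans ((congrArg s hk).trans (hiter' k'))
    exact add_left_cancel this
  have hsr : ∀ p, s p = s 0 + r * p := fun p => by
    rw [← hiter', mul_right_comm, hr, one_mul]
  have hodd_r : Odd r := (even_or_odd r).resolve_left fun he =>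
    not_even_of_odd odd_one (hr ▸ he.mul_right g)
  have hrc : 2 * s 0 + r * c = c := by
    have h1 := hsc 0
    rw [sub_zero, hsr] at h1
    linear_combination h1
  have hss : ∀ p, s (s p) = p ∨ s (s p) = c - p := fun p => hRR _ _ _ (hs p) (hs _)
  have hs0 := hsr 0
  have hs1' := hsr 1
  set a := s 0
  have hss' : ∀ p, s (s p) = a * (1 + r) + r * r * p := fun p => by rw [hsr, hsr p]; ring
  have har : a * (1 + r) = 0 := by
    have := hss 0
    rw [hss', sub_zero, mul_zero, add_zero] at this
    refine this.resolve_right fun h1 => not_even_of_odd hodd ?_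
    rw [← h1]
    exact (odd_one.add_odd hodd_r).mul_left a
  have hrr : r * r = 1 := by
    have := hss 1
    rw [hss', har, zero_add, mul_one] at this
    refine this.resolve_right fun h1 => not_even_of_odd (hodd_r.mul hodd_r) ?_
    rw [h1]
    exact hodd.sub_odd odd_one
  have hη : (2 : ZMod (2 ^ (u + 1))) ^ u + 2 ^ u = 0 := half_add_half
  obtain ⟨m, hm, hm2⟩ := exists_even_two_mul_eq_half hu
  have hcη := half_mul_odd hodd
  refine ⟨hs1, ?_⟩
  rcases sq_eq_one hrr with h1 | h1 | h1 | h1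
  · rw [h1] at hsr har
    rcases eq_zero_or_eq_half (a := a) (by linear_combination har) with ha | ha
    · exact absurd (by rw [hsr, ha]; ring) (hRp 0 _ (hs 0)).1
    · left; intro p; rw [hsr, ha]; ring
  · rw [h1] at hsr hrc
    rcases eq_zero_or_eq_half (a := a - c) (by linear_combination hrc) with ha | ha
    · exact absurd (by rw [hsr]; linear_combination ha) (hRp 0 _ (hs 0)).2
    · right; intro p; rw [hsr]; linear_combination ha + hη
  · exfalso
    rw [h1] at har hrc
    have h2 : 2 * (a + m) = 0 := by linear_combination hrc - hcη + hm2
    have h3 : Even a := by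
      have : Even (a + m) := by
        rcases eq_zero_or_eq_half h2 with h | h
        · rw [h]; exact Even.zero
        · rw [h]; exact even_half hu
      simpa using this.sub hm
    exact half_ne_zero (u := u) (by linear_combination hrc - hcη - har + half_mul_even h3)
  · exfalso
    rw [h1] at har hrc
    have h2 : 2 * (a + m - c) = 0 := by linear_combination hrc - hcη + hm2
    have h3 : Even (a + m - c) := by
      rcases eq_zero_or_eq_half h2 with h | h
      · rw [h]; exact Even.zero
      · rw [h]; exact even_half hu
    have h4 : Even a := (even_or_odd a).resolve_right fun ha => half_ne_zero (u := u) <| by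
      linear_combination har - half_mul_odd ha
    exact not_even_of_odd ((h4.add hm).sub_odd hodd) h3

/-- A cycle set of size at least `8` whose diagonal is a full cycle is retractable. -/
theorem not_injective (hu : 2 ≤ u) (h : CycleLaw σ) (hd : ∀ x, σ x x = x + 1) :
    ¬ Function.Injective σ := by
  intro hinj
  have hbad : ¬ ∀ x y, σ x (y + 2 ^ u) = σ x y + 2 ^ u := by
    intro hall
    refine half_ne_zero (u := u) ?_
    have : σ (0 + 2 ^ u) = σ 0 := Perm.ext fun y => by
      have h1 := half_automorphism h hd 0 y
      rw [hall] at h1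
      exact add_right_cancel h1
    simpa using hinj this
  obtain ⟨c, hodd, hcG⟩ := exists_central_reflection hu h hd hbad
  obtain ⟨w, hw, hww, hwp, hwc⟩ := exists_almost_central hu h hd hcG
  have hc : ∀ x y, σ x (c - y) = c - σ x y := fun x => hcG _ (mem_permGroup_self σ x)
  let R : ZMod (2 ^ (u + 1)) → ZMod (2 ^ (u + 1)) → Prop := fun p q => q = w p ∨ q = c - w p
  have hRσ : ∀ x p q, R p q → R (σ x p) (σ x q) := by
    rintro x p q (rfl | rfl) <;> rcases hw x p with h1 | h1
    · left; rw [h1]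
    · right; rw [h1]; ring
    · right; rw [h1, hc]
    · left; rw [h1, hc]
  have hRc : ∀ p q, R p q → R (c - p) (c - q) := by
    rintro p q (rfl | rfl)
    · left; rw [hwc]
    · right; rw [hwc]
  have hRp : ∀ p q, R p q → q ≠ p ∧ q ≠ c - p := by
    rintro p q (rfl | rfl)
    · exact hwp p
    · refine ⟨fun h1 => (hwp p).2 ?_, fun h1 => (hwp p).1 ?_⟩
      · linear_combination -h1
      · linear_combination -h1
  have hRR : ∀ p q q', R p q → R q q' → q' = p ∨ q' = c - p := by
    rintro p q q' (rfl | rfl) (rfl | rfl) <;> rcases hww p with h1 | h1 <;> simp [hwc, h1]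
  have hRq : ∀ p q q', R p q → R p q' → q' = q ∨ q' = c - q := by
    rintro p q q' (rfl | rfl) (rfl | rfl) <;> simp
  have hDc1 : ∀ p, σ (w (c - p)) (c - p) - (c - p) = -(σ (c - w p) p - p) := fun p => by
    rw [hwc, hc]; ring
  have hDc2 : ∀ p, σ (c - w (c - p)) (c - p) - (c - p) = -(σ (w p) p - p) := fun p => by
    rw [hwc, sub_sub_cancel, hc]; ring
  obtain ⟨g, hg0⟩ : ∃ g, σ (w 0) 0 - 0 = g := ⟨_, rfl⟩
  obtain ⟨g', hg0'⟩ : ∃ g', σ (c - w 0) 0 - 0 = g' := ⟨_, rfl⟩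
  -- By `law_diag`, the unordered pair of displacements of `p` under its two partners does not
  -- depend on `p`.
  have hD : ∀ p, (σ (w p) p - p = g ∧ σ (c - w p) p - p = g') ∨
      (σ (w p) p - p = g' ∧ σ (c - w p) p - p = g) := by
    refine induction ⟨0, Or.inl ⟨hg0, hg0'⟩⟩ fun p hp => ?_
    have e1 : σ (σ p (w p)) (p + 1) - (p + 1) = σ (w p) p - p := by rw [law_diag h hd]; ring
    have e2 : σ (c - σ p (w p)) (p + 1) - (p + 1) = σ (c - w p) p - p := by
      rw [← hc, law_diag h hd]; ring
    have h1 := hw p p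
    rw [hd] at h1
    rcases h1 with h1 | h1 <;> rw [h1]
    · rwa [e1, e2]
    · rw [sub_sub_cancel, e1, e2]; exact hp.symm.imp And.symm And.symm
  -- Otherwise the partners of `0` and of `2 ^ u` form a `T`-stable set of at most four points.
  have hne : ¬ (2 * g = 0 ∧ 2 * g' = 0) := by
    intro h2
    have hηη : (2 : ZMod (2 ^ (u + 1))) ^ u + 2 ^ u = 0 := half_add_half
    have hRg : ∀ p q, R p q → σ q p = p ∨ σ q p = p + 2 ^ u := by
      have : ∀ p q, R p q → σ q p - p = 0 ∨ σ q p - p = 2 ^ u := by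
        rintro p q (h5 | h5) <;> rw [h5] <;> apply eq_zero_or_eq_half <;>
          rcases hD p with ⟨h3, h4⟩ | ⟨h3, h4⟩
        · rw [h3, h2.1]
        · rw [h3, h2.2]
        · rw [h4, h2.2]
        · rw [h4, h2.1]
      exact fun p q hpq => (this p q hpq).imp (fun h => by linear_combination h)
        (fun h => by linear_combination h)
    have hall : ∀ q, R 0 q ∨ R (2 ^ u) q := by
      refine induction ⟨w 0, Or.inl (Or.inl rfl)⟩ fun q hq => ?_
      rcases hq with hq | hq <;> have h3 := hRσ q _ _ hq <;> rw [hd] at h3 <;>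
        rcases hRg _ _ hq with h4 | h4 <;> rw [h4] at h3
      · exact Or.inl h3
      · rw [zero_add] at h3; exact Or.inr h3
      · exact Or.inr h3
      · rw [hηη] at h3; exact Or.inl h3
    have hsub : (Finset.univ : Finset (ZMod (2 ^ (u + 1)))) ⊆
        {w 0, c - w 0, w (2 ^ u), c - w (2 ^ u)} := fun q _ => by
      rcases hall q with (h1 | h1) | (h1 | h1) <;> simp [h1]
    have h3 := (Finset.card_le_card hsub).trans Finset.card_le_four
    rw [Finset.card_univ, ZMod.card] at h3
    have h4 : 2 ^ (2 + 1) ≤ 2 ^ (u + 1) := Nat.pow_le_pow_right two_pos (by omega)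
    omega
  -- Reflecting the base point negates and swaps the two displacements.
  have hgg : g' = -g := by
    have h1 := hD (c - 0)
    rw [hDc1, hDc2, hg0, hg0'] at h1
    rcases h1 with h1 | h1
    · linear_combination -h1.1
    · exact absurd ⟨by linear_combination -h1.2, by linear_combination -h1.1⟩ hne
  have hg2 : 2 * g ≠ 0 := fun h2 => hne ⟨h2, by rw [hgg]; linear_combination -h2⟩
  rw [hgg] at hD
  have hex : ∀ p, ∃ q, R p q ∧ σ q p = p + g ∧ σ (c - q) p = p - g := by
    intro p
    rcases hD p with ⟨h1, h2⟩ | ⟨h1, h2⟩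
    · exact ⟨w p, Or.inl rfl, by linear_combination h1, by linear_combination h2⟩
    · exact ⟨c - w p, Or.inr rfl, by linear_combination h2, by
        rw [sub_sub_cancel]; linear_combination h1⟩
  choose s hs hsg hsg' using hex
  obtain ⟨hs1, hsp⟩ := selector_eq hu h hd hodd hRσ hRc hRp hRR hRq hg2 hs hsg hsg' hc
  have hsR : ∀ p q, R p q ↔ q = s p ∨ q = c - s p := by
    intro p q
    refine ⟨hRq p _ _ (hs p), ?_⟩
    rintro (rfl | rfl)
    · exact hs p
    · rcases hs p with h1 | h1 <;> rw [h1]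
      · right; rfl
      · left; ring
  have hRη : ∀ p q, R p q ↔ q = p + 2 ^ u ∨ q = c - (p + 2 ^ u) := by
    intro p q
    rw [hsR]
    rcases hsp with h1 | h1 <;> rw [h1]
    rw [sub_sub_cancel, or_comm]
  refine hbad (half_commutes hu h hd hodd hc (fun x y => ?_) fun p => ?_)
  · exact (hRη _ _).1 (hRσ x _ _ ((hRη _ _).2 (Or.inl rfl)))
  · have h1 := hs1 p
    rcases hsp with h2 | h2 <;> rw [h2, h2] at h1
    · exact h1.symm
    · rw [hc] at h1
      linear_combination h1

end TwoPowMod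

/-! ### Coordinates and the irretractable case -/

namespace CycleSet

theorem isCycleOn_finset {X : CycleSet.{u}} [Fintype X.carrier] (hT : X.HasFullDiagonal) :
    X.diagonal.IsCycleOn (Finset.univ : Finset X.carrier) := by
  rw [Finset.coe_univ]
  exact hT

theorem exists_coordinates {X : CycleSet.{u}} (hT : X.HasFullDiagonal) {n : ℕ} [NeZero n]
    (hcard : Nat.card X.carrier = n) :
    ∃ e : ZMod n ≃ X.carrier, ∀ k, X.op (e k) (e k) = e (k + 1) := by
  have := Fintype.ofFinite X.carrier
  rw [Nat.card_eq_fintype_card] at hcard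
  have : Nonempty X.carrier := Fintype.card_pos_iff.1 (hcard ▸ Nat.pos_of_ne_zero (NeZero.ne n))
  obtain ⟨x⟩ := this
  have hpow : ∀ a b : ℕ, (X.diagonal ^ a) x = (X.diagonal ^ b) x ↔ a ≡ b [MOD n] := fun a b => by
    rw [← hcard, ← Finset.card_univ]
    exact (isCycleOn_finset hT).pow_apply_eq_pow_apply (Finset.mem_univ x)
  have hinj : Function.Injective fun k : ZMod n => (X.diagonal ^ k.val) x := fun k l hkl => by
    have := (ZMod.natCast_eq_natCast_iff _ _ _).2 ((hpow _ _).1 hkl)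
    rwa [ZMod.natCast_zmod_val, ZMod.natCast_zmod_val] at this
  refine ⟨Equiv.ofBijective _ ((Fintype.bijective_iff_injective_and_card _).2
    ⟨hinj, by rw [ZMod.card, hcard]⟩), fun k => ?_⟩
  show X.diagonal ((X.diagonal ^ k.val) x) = (X.diagonal ^ (k + 1).val) x
  rw [← Perm.mul_apply, ← pow_succ', hpow, ← ZMod.natCast_eq_natCast_iff]
  push_cast
  rw [ZMod.natCast_zmod_val, ZMod.natCast_zmod_val]

/-- Translation by 2 determines rows 2 and 3 from rows 0 and 1, so only these two rows are
enumerated. The surviving tables are that of `X419` and its conjugate by `x ↦ x + 1`. -/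
theorem four_tables : ∀ a b c : Fin 4, [1, a, b, c].Nodup → ∀ d e g : Fin 4, [d, 2, e, g].Nodup →
    ∀ f : Fin 4 → Fin 4 → Fin 4, f = ![![1, a, b, c], ![d, 2, e, g],
      ![b + 2, c + 2, 3, a + 2], ![e + 2, g + 2, d + 2, 0]] →
    (∀ x y z, f (f x y) (f x z) = f (f y x) (f y z)) → (∃ y, f 0 y ≠ f 2 y) →
    (∀ x y, f x y = table419 x y) ∨ ∀ x y, f (x + 1) (y + 1) = table419 x y + 1 := by
  suffices H : ∀ a b c : Fin 4, [1, a, b, c].Nodup → ∀ d e g : Fin 4, [d, 2, e, g].Nodup →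
    let f : Fin 4 → Fin 4 → Fin 4 := ![![1, a, b, c], ![d, 2, e, g],
      ![b + 2, c + 2, 3, a + 2], ![e + 2, g + 2, d + 2, 0]]
    (∀ x y z, f (f x y) (f x z) = f (f y x) (f y z)) → (∃ y, f 0 y ≠ f 2 y) →
    (∀ x y, f x y = table419 x y) ∨ ∀ x y, f (x + 1) (y + 1) = table419 x y + 1 by
    intro a b c h1 d e g h2 f hf
    subst hf
    exact H a b c h1 d e g h2
  decide

theorem four_points {f : Fin 4 → Fin 4 → Fin 4} (hinj : ∀ x, Function.Injective (f x))
    (hlaw : ∀ x y z, f (f x y) (f x z) = f (f y x) (f y z)) (hd : ∀ x, f x x = x + 1)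
    (ht : ∀ x y, f (x + 2) (y + 2) = f x y + 2) (hne : f 0 ≠ f 2) :
    (∀ x y, f x y = table419 x y) ∨ ∀ x y, f (x + 1) (y + 1) = table419 x y + 1 := by
  refine four_tables (f 0 1) (f 0 2) (f 0 3) ?_ (f 1 0) (f 1 2) (f 1 3) ?_ f ?_ hlaw
    (Function.ne_iff.1 hne)
  · have := (List.nodup_map_iff (hinj 0) (l := [0, 1, 2, 3])).2 (by decide)
    simpa only [List.map_cons, List.map_nil, hd 0, zero_add] using this
  · have := (List.nodup_map_iff (hinj 1) (l := [0, 1, 2, 3])).2 (by decide)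
    simpa only [List.map_cons, List.map_nil, hd 1, show (1 : Fin 4) + 1 = 2 from rfl] using this
  · funext x y
    fin_cases x <;> fin_cases y
    exacts [hd 0, rfl, rfl, rfl, rfl, hd 1, rfl, rfl, ht 0 2, ht 0 3, hd 2, ht 0 1, ht 1 2, ht 1 3,
      ht 1 0, hd 3]

/-- An irretractable cycle set of size a power of two with a full diagonal is a point or
isomorphic to `X419`. -/
theorem card_eq_one_or_iso {X : CycleSet.{u}} {v : ℕ} (hcard : Nat.card X.carrier = 2 ^ v)
    (hT : X.HasFullDiagonal) (hinj : Function.Injective X.sigma) :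
    Nat.card X.carrier = 1 ∨ Nonempty (X.Iso X419) := by
  obtain _ | m := v
  · exact Or.inl hcard
  right
  obtain ⟨e, he⟩ := exists_coordinates hT hcard
  let σ : ZMod (2 ^ (m + 1)) → Perm (ZMod (2 ^ (m + 1))) := fun k => e.symm.permCongr (X.sigma (e k))
  have hσ : ∀ x y, e (σ x y) = X.op (e x) (e y) := fun x y => by
    simp [σ, Equiv.permCongr_apply]
  have h : CycleLaw σ := fun x y z => e.injective <| by
    simp only [hσ, X.op_op]
  have hd : ∀ x, σ x x = x + 1 := fun x => e.injective <| by rw [hσ, he]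
  have hσinj : Function.Injective σ := fun x y hxy =>
    e.injective (hinj (e.symm.permCongr.injective hxy))
  have ht := TwoPowMod.half_automorphism h hd
  obtain _ | _ | m := m
  · have h2 : ∀ f : Fin 2 → Fin 2 → Fin 2, (∀ x, Function.Injective (f x)) →
        (∀ x, f x x = x + 1) → ∀ y, f 0 y = f 1 y := by decide
    have h3 : σ 0 = σ 1 := Perm.ext (h2 (fun x y => σ x y) (fun x => (σ x).injective) hd)
    exact absurd (hσinj h3) (by decide)
  · have hne : σ 0 ≠ σ 2 := fun h => absurd (hσinj h) (by decide)
    -- `ZMod (2 ^ (1 + 1))` is `Fin 4` by unfolding.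
    have hfour := four_points (f := fun x y => σ x y) (fun x => (σ x).injective) h hd ht
      fun h => hne (Perm.ext (congrFun h))
    rcases hfour with h1 | h1
    · refine ⟨⟨e.symm, fun x y => ?_⟩⟩
      obtain ⟨x, rfl⟩ := e.surjective x
      obtain ⟨y, rfl⟩ := e.surjective y
      simp only [← hσ, Equiv.toFun_as_coe, Equiv.symm_apply_apply]
      exact h1 x y
    · let φ : X.carrier ≃ ZMod (2 ^ (1 + 1)) := e.symm.trans (Equiv.subRight 1)
      have hφ : ∀ a, φ (e a) = a - 1 := fun a => by simp [φ]
      refine ⟨⟨φ, fun x y => ?_⟩⟩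
      obtain ⟨x, rfl⟩ := ((Equiv.addRight 1).trans e).surjective x
      obtain ⟨y, rfl⟩ := ((Equiv.addRight 1).trans e).surjective y
      show φ (X.op (e (x + 1)) (e (y + 1))) = table419 (φ (e (x + 1))) (φ (e (y + 1)))
      rw [← hσ, hφ, hφ, hφ, add_sub_cancel_right, add_sub_cancel_right]
      exact sub_eq_of_eq_add (h1 x y)
  · exact absurd hσinj (TwoPowMod.not_injective (by omega) h hd)

/-! ### Iterated retractions and the dichotomy -/

theorem card_eq_of_iso {X : CycleSet.{u}} (φ : X.Iso X419) : Nat.card X.carrier = 4 := by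
  rw [Nat.card_congr φ.toEquiv]
  exact Nat.card_fin 4

theorem sigma_injective_of_iso {X : CycleSet.{u}} (φ : X.Iso X419) :
    Function.Injective X.sigma := by
  intro x y hxy
  have key : ∀ a b : Fin 4, (∀ c, table419 a c = table419 b c) → a = b := by decide
  refine φ.injective (key _ _ fun c => ?_)
  obtain ⟨z, rfl⟩ := φ.surjective c
  have h1 : X.op x z = X.op y z := DFunLike.congr_fun hxy z
  exact (φ.map_op x z).symm.trans ((congrArg φ.toFun h1).trans (φ.map_op y z))

/-- The quotient map to the retraction. -/
noncomputable def toRet (X : CycleSet.{u}) (x : X.carrier) : X.ret.carrier := Quotient.mk X.retSetoid x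

theorem toRet_surjective (X : CycleSet.{u}) : Function.Surjective X.toRet :=
  Quotient.mk_surjective

theorem toRet_eq_iff {X : CycleSet.{u}} {x y : X.carrier} :
    X.toRet x = X.toRet y ↔ X.sigma x = X.sigma y :=
  Quotient.eq

theorem toRet_bijective {X : CycleSet.{u}} (hinj : Function.Injective X.sigma) :
    Function.Bijective X.toRet :=
  ⟨fun _ _ hxy => hinj (toRet_eq_iff.1 hxy), X.toRet_surjective⟩

theorem ret_iso {X : CycleSet.{u}} (φ : X.Iso X419) : Nonempty (X.ret.Iso X419) := by
  let m : X.carrier ≃ X.ret.carrier := Equiv.ofBijective _ (toRet_bijective (sigma_injective_of_iso φ))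
  refine ⟨⟨m.symm.trans φ.toEquiv, fun x y => ?_⟩⟩
  obtain ⟨x, rfl⟩ := m.surjective x
  obtain ⟨y, rfl⟩ := m.surjective y
  have h1 : X.ret.op (m x) (m y) = m (X.op x y) := rfl
  rw [h1]
  simpa using φ.map_op x y

theorem iterRet_iso {X : CycleSet.{u}} {j k : ℕ} (hjk : j ≤ k)
    (h : Nonempty ((X.iterRet j).Iso X419)) : Nonempty ((X.iterRet k).Iso X419) := by
  induction k, hjk using Nat.le_induction with
  | base => exact h
  | succ k _ ih => exact ih.elim fun φ => ret_iso φ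

theorem card_ret_le (X : CycleSet.{u}) : Nat.card X.ret.carrier ≤ Nat.card X.carrier :=
  Nat.card_le_card_of_surjective _ X.toRet_surjective

theorem card_ret_lt {X : CycleSet.{u}} (hinj : ¬ Function.Injective X.sigma) :
    Nat.card X.ret.carrier < Nat.card X.carrier := by
  refine (card_ret_le X).lt_of_ne fun h => hinj fun x y hxy => ?_
  have hb := (Nat.bijective_iff_surjective_and_card X.toRet).2 ⟨X.toRet_surjective, h.symm⟩
  exact hb.1 (toRet_eq_iff.2 hxy)

theorem card_iterRet_antitone (X : CycleSet.{u}) :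
    Antitone fun k => Nat.card (X.iterRet k).carrier :=
  antitone_nat_of_succ_le fun k => card_ret_le (X.iterRet k)

theorem iterRet_ret (X : CycleSet.{u}) (k : ℕ) : X.ret.iterRet k = X.iterRet (k + 1) := by
  induction k with
  | zero => rfl
  | succ k ih => exact congrArg ret ih

theorem diagonal_ret_pow (X : CycleSet.{u}) (k : ℕ) (x : X.carrier) :
    (X.ret.diagonal ^ k) (X.toRet x) = X.toRet ((X.diagonal ^ k) x) := by
  induction k with
  | zero => rfl
  | succ k ih =>
    rw [pow_succ', pow_succ', Perm.mul_apply, ih]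
    rfl

theorem HasFullDiagonal.ret {X : CycleSet.{u}} (hT : X.HasFullDiagonal) :
    X.ret.HasFullDiagonal := by
  have := Fintype.ofFinite X.carrier
  refine ⟨Set.bijOn_univ.2 X.ret.diagonal.bijective, fun p _ q _ => ?_⟩
  obtain ⟨x, rfl⟩ := X.toRet_surjective p
  obtain ⟨y, rfl⟩ := X.toRet_surjective q
  obtain ⟨k, hk⟩ := (hT.2 (Set.mem_univ x) (Set.mem_univ y)).exists_nat_pow_eq
  refine ⟨k, ?_⟩
  rw [zpow_natCast]
  exact (diagonal_ret_pow X k x).trans (congrArg _ hk)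

/-- The relation `T ^ n = 1`, with `n` the size of `X`, descends to the retraction, where `T` is one
cycle of length the size of the retraction. -/
theorem HasFullDiagonal.card_ret_dvd {X : CycleSet.{u}} (hT : X.HasFullDiagonal)
    [Nonempty X.carrier] : Nat.card X.ret.carrier ∣ Nat.card X.carrier := by
  have := Fintype.ofFinite X.carrier
  have := Fintype.ofFinite X.ret.carrier
  obtain ⟨x⟩ := ‹Nonempty X.carrier›
  rw [Nat.card_eq_fintype_card, Nat.card_eq_fintype_card, ← Finset.card_univ,
    ← (isCycleOn_finset hT.ret).pow_apply_eq (Finset.mem_univ (X.toRet x)),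
    diagonal_ret_pow, ← Finset.card_univ,
    (isCycleOn_finset hT).pow_card_apply (Finset.mem_univ x)]

theorem exists_card_eq_one_or_iso (v : ℕ) {X : CycleSet.{u}} (hcard : Nat.card X.carrier = 2 ^ v)
    (hT : X.HasFullDiagonal) :
    (∃ k, Nat.card (X.iterRet k).carrier = 1) ∨ ∃ k, Nonempty ((X.iterRet k).Iso X419) := by
  induction v using Nat.strong_induction_on generalizing X with | _ v ih =>
  by_cases hinj : Function.Injective X.sigma
  · exact (card_eq_one_or_iso hcard hT hinj).imp (fun h => ⟨0, h⟩) fun h => ⟨0, h⟩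
  have hne : Nonempty X.carrier := (Nat.card_pos_iff.1 (hcard ▸ by positivity)).1
  obtain ⟨j, -, hj⟩ := (Nat.dvd_prime_pow Nat.prime_two).1 (hcard ▸ hT.card_ret_dvd)
  have hjv : j < v := (Nat.pow_lt_pow_iff_right one_lt_two).1 (hj ▸ hcard ▸ card_ret_lt hinj)
  have := ih j hjv hj hT.ret
  simp only [iterRet_ret] at this
  exact this.imp (fun ⟨k, hk⟩ => ⟨k + 1, hk⟩) fun ⟨k, hk⟩ => ⟨k + 1, hk⟩

theorem mpl_lt_top_iff (X : CycleSet.{u}) :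
    X.mpl < ⊤ ↔ ∃ k, Nat.card (X.iterRet k).carrier = 1 := by
  simp [mpl, iInf_lt_iff]

end CycleSet

theorem mainTheorem4 (X : CycleSet.{u}) (v : ℕ) (hcard : Nat.card X.carrier = 2 ^ v)
    (hT : X.HasFullDiagonal) :
    Xor (X.mpl < ⊤) (∃ k : ℕ, Nonempty ((X.iterRet k).Iso CycleSet.X419)) := by
  rw [CycleSet.mpl_lt_top_iff]
  have hnot : ¬ ((∃ k, Nat.card (X.iterRet k).carrier = 1) ∧
      ∃ k : ℕ, Nonempty ((X.iterRet k).Iso CycleSet.X419)) := by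
    rintro ⟨⟨k, hk⟩, j, hj⟩
    -- At stage `max j k` the size would be 4 and at most 1.
    obtain ⟨φ⟩ := CycleSet.iterRet_iso (le_max_left j k) hj
    have h1 := CycleSet.card_iterRet_antitone X (le_max_right j k)
    have h2 := CycleSet.card_eq_of_iso φ
    simp only [hk, h2] at h1
    omega
  rcases CycleSet.exists_card_eq_one_or_iso v hcard hT with h | h
  · exact Or.inl ⟨h, fun h' => hnot ⟨h, h'⟩⟩
  · exact Or.inr ⟨h, fun h' => hnot ⟨h', h⟩⟩
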